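/- Let $(\Sigma,\mathbb M,\mathbb O)$ be an oriented compact connected surface with (possibly empty) boundary, a finite non-empty set $\mathbb M$ of marked points meeting every boundary component, and a finite set $\mathbb O\subseteq\Sigma\setminus(\partial\Sigma\cup\mathbb M)$ of orbifold points. Assume that either $\mathbb M\subseteq\partial\Sigma$, or $\partial\Sigma=\varnothing$ and $|\mathbb M|=1$. Let $\omega:\mathbb O\to\{1,4\}$, and let $\tau$ be an ideal triangulation: its arcs cut $\Sigma$ into triangles; a non-pending arc is two sides of triangles, and a pending arc, which joins a marked point to an orbifold point $q_j$, is one side of one triangle, folded around $q_j$; every orbifold point lies on exactly one pending arc. For a pending arc $j$ put $d_j=\omega(q_j)$. Let $\overline Q(\tau)$ be the quiver whose vertices are the arcs, with one arrow $i\to j$ whenever the side $j$ follows the side $i$ in a triangle with respect to the orientation (boundary segments being disregarded). Let $\xi:\overline Q(\tau)_1\to\mathbb F_2$ be a $1$-cocycle, that is, $\xi_\alpha+\xi_\beta+\xi_\gamma=0$ whenever $\alpha,\beta,\gamma$ are the three arrows of a triangle without boundary segments. Let $\widehat Q(\tau)$ be obtained from $\overline Q(\tau)$ by adding one loop $s_j$,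 called special, at each pending arc $j$. Let $E/F$ be a cyclic Galois extension of degree $d$, where $d=4$, or $d=2$ and $\omega\equiv 1$; let $F$ contain a primitive $d$-th root of unity $\zeta$, let $\rho$ generate $\mathrm{Gal}(E/F)$, and let $0\ne v\in E$ with $\rho(v)=\zeta v$. Put $L=\mathrm{Fix}_E(\rho^2)$, so that $[L:F]=2$, $\theta=\rho|_L$, and $u=v^{d/2}\in L$. Put $\sigma_a=\theta^{\xi_a}$ for $a\in\overline Q(\tau)_1$, and $\sigma_{s_j}=\theta$, $q_{s_j}(x)=x^2-1\in L[x;\theta]$ if $d_j=1$, and $\sigma_{s_j}=1_L$, $q_{s_j}(x)=x^2-u\in L[x]$ if $d_j=4$. Let $L_{\sigma}\widehat Q(\tau)$ be the semilinear path algebra, in which $a\lambda=\sigma_a(\lambda)a$ for $\lambda\in L$ and every arrow $a$. Let $Z(\tau,\xi)$ be the set of paths of length two formed by two consecutive arrows of one and the same triangle without boundary segments, and let $I(\tau,\xi)$ be the two-sided ideal generated by $Z(\tau,\xi)$ and the elements $s_j^2-e_j$ ($d_j=1$) and $s_j^2-ue_j$ ($d_j=4$). Then $L_{\sigma}\widehat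 Q(\tau)/I(\tau,\xi)$, with these special loops and relations, is a semilinear clannish algebra, that is: * at most two arrows of $\widehat Q(\tau)$ start, and at most two end, at any given vertex; * $Z(\tau,\xi)$ consists of paths of length at least two; for every ordinary (that is, non-special) arrow $a$ there is at most one arrow $b$ such that $ba$ is a path outside $Z(\tau,\xi)$, and at most one arrow $b$ such that $ab$ is a path outside $Z(\tau,\xi)$; no path in $Z(\tau,\xi)$ starts or ends with a special loop $s$ or contains $s^2$; * $I(\tau,\xi)$ is generated by $Z(\tau,\xi)$ and the elements $s^2-\beta_s s+\gamma_s e_{h(s)}$ given by the quadratics $q_s(x)=x^2-\beta_s x+\gamma_s\in L[x;\sigma_s]$, one for each special loop $s$; here $L/F$ is a cyclic Galois extension of finite degree. Moreover it is normally-bound ($L[x;\sigma_s]q_s=q_sL[x;\sigma_s]$ for every special loop $s$), non-singular (every $q_s$ has nonzero constant term) and of semisimple type (every ring $L[x;\sigma_s]/\langle q_s\rangle$ is semisimple). -/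

import Mathlib

open scoped Manifold

noncomputable section

/-! ## Semilinear path algebras -/

/-- A finite quiver `(Q₀, Q₁, t, h)`: finitely many vertices and arrows, every arrow `a` going from
its tail `t a` to its head `h a`. -/
structure FiniteQuiver where
  /-- vertices -/
  V : Type
  /-- arrows -/
  A : Type
  finV : Finite V
  finA : Finite A
  /-- tail -/
  t : A → V
  /-- head -/
  h : A → V

namespace FiniteQuiver

variable (Q : FiniteQuiver)

instance : Finite Q.V := Q.finV
instance : Finite Q.A := Q.finA
instance : Fintype Q.V := Fintype.ofFinite Q.V

/-- `Q.IsPath w l v`: the list `l = [aₙ, …, a₁]` is a path `aₙ ⋯ a₁` from `v` to `w`, arrows being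
composed from right to left, like maps. The empty list is a path from `v` to `v` only. -/
def IsPath : Q.V → List Q.A → Q.V → Prop
  | w, [], v => w = v
  | w, a :: l, v => Q.h a = w ∧ IsPath (Q.t a) l v

theorem IsPath.append {Q : FiniteQuiver} {w v u : Q.V} {l l' : List Q.A}
    (hl : Q.IsPath w l v) (hl' : Q.IsPath v l' u) : Q.IsPath w (l ++ l') u := by
  induction l generalizing w with
  | nil =>
    have : w = v := hl
    subst this
    exact hl'
  | cons a l ih => exact ⟨hl.1, ih hl.2⟩

/-- The paths of a quiver, including the trivial path at each vertex. -/
@[ext] structure Path where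
  /-- end vertex -/
  tgt : Q.V
  /-- the arrows, the last one to be travelled first in the list -/
  arrows : List Q.A
  /-- start vertex -/
  src : Q.V
  isPath : Q.IsPath tgt arrows src

variable {Q}

/-- The trivial path at a vertex. -/
def Path.trivial (v : Q.V) : Q.Path := ⟨v, [], v, rfl⟩

/-- An arrow as a path of length one. -/
def Path.ofArrow (a : Q.A) : Q.Path := ⟨Q.h a, [a], Q.t a, rfl, rfl⟩

/-- The path `b a` of length two (first `a`, then `b`). -/
def Path.pair (b a : Q.A) (hba : Q.t b = Q.h a) : Q.Path :=
  ⟨Q.h b, [b, a], Q.t a, rfl, hba.symm, rfl⟩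

/-- The concatenation `p q` (first `q`, then `p`). -/
def Path.comp (p q : Q.Path) (hpq : p.src = q.tgt) : Q.Path :=
  ⟨p.tgt, p.arrows ++ q.arrows, q.src, p.isPath.append (hpq ▸ q.isPath)⟩

end FiniteQuiver

section PathAlgebra

variable {F K : Type*} [Field F] [Field K] [Algebra F K] {Q : FiniteQuiver}

/-- The automorphism `σ_p = σ_{aₙ} ∘ ⋯ ∘ σ_{a₁}` attached to a path `p = aₙ ⋯ a₁`. -/
def pathTwist (σ : Q.A → (K ≃ₐ[F] K)) (p : Q.Path) : K ≃ₐ[F] K := (p.arrows.map σ).prod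

/-- The semilinear path algebra `K_σ Q`: the tensor ring, over the product `S` of copies of `K`
indexed by the vertices, of the direct sum over the arrows `a` of the `S`-`S`-bimodules `K a` on
which `K` acts on the left at the vertex `h a` by multiplication and on the right at the vertex
`t a` through `a c = σ_a(c) a`. Its degree `n` component has the paths of length `n` as a left
`K`-basis, so that it consists of the finite sums `∑ c_p p` with `c_p ∈ K` and `p` a path; the
product of `c p` and `d q` is `c σ_p(d) (p q)` if `p q` is a path, and `0` otherwise. -/
def PathAlgebra (_σ : Q.A → (K ≃ₐ[F] K)) : Type _ := Q.Path →₀ K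

namespace PathAlgebra

variable (σ : Q.A → (K ≃ₐ[F] K))

instance : AddCommGroup (PathAlgebra σ) := inferInstanceAs (AddCommGroup (Q.Path →₀ K))

/-- The element `c p` of `K_σ Q`. -/
def term (p : Q.Path) (c : K) : PathAlgebra σ := Finsupp.single p c

open scoped Classical in
/-- The product of `c p` and `d q`. -/
def termMul (p : Q.Path) (c : K) (q : Q.Path) (d : K) : PathAlgebra σ :=
  if hpq : p.src = q.tgt then term σ (p.comp q hpq) (c * pathTwist σ p d) else 0

theorem term_zero (p : Q.Path) : term σ p (0 : K) = 0 := Finsupp.single_zero p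

theorem term_add (p : Q.Path) (c d : K) : term σ p (c + d) = term σ p c + term σ p d :=
  Finsupp.single_add p c d

theorem termMul_zero_left (p q : Q.Path) (d : K) : termMul σ p 0 q d = 0 := by
  unfold termMul; split_ifs <;> simp [term_zero]

theorem termMul_zero_right (p q : Q.Path) (c : K) : termMul σ p c q 0 = 0 := by
  unfold termMul; split_ifs <;> simp [term_zero]

theorem termMul_add_left (p q : Q.Path) (c c' d : K) :
    termMul σ p (c + c') q d = termMul σ p c q d + termMul σ p c' q d := by
  unfold termMul; split_ifs <;> simp [add_mul, term_add]

theorem termMul_add_right (p q : Q.Path) (c d d' : K) :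
    termMul σ p c q (d + d') = termMul σ p c q d + termMul σ p c q d' := by
  unfold termMul; split_ifs <;> simp [mul_add, term_add]

/-- The additive maps out of `K_σ Q` given by their values on the elements `c p`. -/
def lift {M : Type*} [AddCommMonoid M] (f : Q.Path → K →+ M) : PathAlgebra σ →+ M :=
  Finsupp.liftAddHom (M := K) (N := M) f

theorem lift_term {M : Type*} [AddCommMonoid M] (f : Q.Path → K →+ M) (p : Q.Path) (c : K) :
    lift σ f (term σ p c) = f p c :=
  Finsupp.liftAddHom_apply_single (M := K) (N := M) f p c

theorem addHom_ext {M : Type*} [AddCommMonoid M] {f g : PathAlgebra σ →+ M}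
    (hfg : ∀ p c, f (term σ p c) = g (term σ p c)) : f = g :=
  Finsupp.addHom_ext (M := K) (N := M) hfg

/-- Left multiplication by `c p`. -/
def termMulHom (p : Q.Path) (c : K) : PathAlgebra σ →+ PathAlgebra σ :=
  lift σ fun q =>
    { toFun := termMul σ p c q
      map_zero' := termMul_zero_right σ p q c
      map_add' := termMul_add_right σ p q c }

theorem termMulHom_term (p q : Q.Path) (c d : K) :
    termMulHom σ p c (term σ q d) = termMul σ p c q d := lift_term σ _ q d

/-- The multiplication of `K_σ Q`, as a biadditive map. -/
def mulHom : PathAlgebra σ →+ PathAlgebra σ →+ PathAlgebra σ :=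
  lift σ fun p =>
    { toFun := termMulHom σ p
      map_zero' := addHom_ext σ fun q d => by
        rw [termMulHom_term, termMul_zero_left, AddMonoidHom.zero_apply]
      map_add' := fun c c' => addHom_ext σ fun q d => by
        rw [AddMonoidHom.add_apply, termMulHom_term, termMulHom_term, termMulHom_term,
          termMul_add_left] }

theorem mulHom_term (p q : Q.Path) (c d : K) :
    mulHom σ (term σ p c) (term σ q d) = termMul σ p c q d := by
  unfold mulHom
  rw [lift_term]
  exact termMulHom_term σ p q c d

theorem pathTwist_comp (p q : Q.Path) (hpq : p.src = q.tgt) (c : K) :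
    pathTwist σ (p.comp q hpq) c = pathTwist σ p (pathTwist σ q c) := by
  simp [pathTwist, FiniteQuiver.Path.comp]

theorem mulHom_assoc (f g k : PathAlgebra σ) :
    mulHom σ (mulHom σ f g) k = mulHom σ f (mulHom σ g k) := by
  have key : ((mulHom σ).compr₂ (mulHom σ)) =
      (AddMonoidHom.compl₂ ((AddMonoidHom.compHom (N := PathAlgebra σ)).comp (mulHom σ))
        (mulHom σ)) := by
    refine addHom_ext σ fun p c => addHom_ext σ fun q d => addHom_ext σ fun r e => ?_
    change mulHom σ (mulHom σ (term σ p c) (term σ q d)) (term σ r e) =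
      mulHom σ (term σ p c) (mulHom σ (term σ q d) (term σ r e))
    rw [mulHom_term, mulHom_term]
    by_cases hpq : p.src = q.tgt
    · by_cases hqr : q.src = r.tgt
      · have h₁ : (p.comp q hpq).src = r.tgt := hqr
        have h₂ : p.src = (q.comp r hqr).tgt := hpq
        simp only [termMul, dif_pos hpq, dif_pos hqr, mulHom_term, dif_pos h₁, dif_pos h₂]
        rw [pathTwist_comp, map_mul, mul_assoc]
        congr 1
        ext1 <;> simp [FiniteQuiver.Path.comp]
      · have h₁ : ¬ (p.comp q hpq).src = r.tgt := hqr
        simp only [termMul, dif_pos hpq, dif_neg hqr, mulHom_term, dif_neg h₁, map_zero]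
    · by_cases hqr : q.src = r.tgt
      · have h₂ : ¬ p.src = (q.comp r hqr).tgt := hpq
        simp only [termMul, dif_neg hpq, dif_pos hqr, mulHom_term, dif_neg h₂, map_zero,
          AddMonoidHom.zero_apply]
      · simp only [termMul, dif_neg hpq, dif_neg hqr, map_zero, AddMonoidHom.zero_apply]
  exact DFunLike.congr_fun (DFunLike.congr_fun (DFunLike.congr_fun key f) g) k

/-- The diagonal element `∑_v c e_v`. -/
def diag (c : K) : PathAlgebra σ := ∑ v : Q.V, term σ (FiniteQuiver.Path.trivial v) c

theorem diag_mul_term (c : K) (q : Q.Path) (d : K) :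
    mulHom σ (diag σ c) (term σ q d) = term σ q (c * d) := by
  unfold diag
  rw [map_sum, AddMonoidHom.finsetSum_apply, Finset.sum_eq_single q.tgt]
  · rw [mulHom_term, termMul, dif_pos (by rfl)]
    congr 1
  · intro v _ hv
    rw [mulHom_term, termMul, dif_neg]
    exact hv
  · intro hv
    exact absurd (Finset.mem_univ _) hv

theorem term_mul_diag (q : Q.Path) (d c : K) :
    mulHom σ (term σ q d) (diag σ c) = term σ q (d * pathTwist σ q c) := by
  unfold diag
  rw [map_sum, Finset.sum_eq_single q.src]
  · rw [mulHom_term, termMul, dif_pos (by rfl)]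
    congr 1
    ext1 <;> simp [FiniteQuiver.Path.comp, FiniteQuiver.Path.trivial]
  · intro v _ hv
    rw [mulHom_term, termMul, dif_neg]
    exact fun h => hv h.symm
  · intro hv
    exact absurd (Finset.mem_univ _) hv

instance : Ring (PathAlgebra σ) :=
  { (inferInstance : AddCommGroup (PathAlgebra σ)) with
    mul := fun f g => mulHom σ f g
    one := diag σ 1
    left_distrib := fun f g k => map_add (mulHom σ f) g k
    right_distrib := fun f g k => by
      change mulHom σ (f + g) k = mulHom σ f k + mulHom σ g k
      rw [map_add, AddMonoidHom.add_apply]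
    zero_mul := fun f => by
      change mulHom σ 0 f = 0
      rw [map_zero, AddMonoidHom.zero_apply]
    mul_zero := fun f => map_zero (mulHom σ f)
    mul_assoc := mulHom_assoc σ
    one_mul := fun f => by
      have : mulHom σ (diag σ 1) = AddMonoidHom.id _ :=
        addHom_ext σ fun p c => by simp [diag_mul_term]
      exact DFunLike.congr_fun this f
    mul_one := fun f => by
      have : (mulHom σ).flip (diag σ 1) = AddMonoidHom.id _ :=
        addHom_ext σ fun p c => by simp [term_mul_diag]
      exact DFunLike.congr_fun this f }

theorem mul_def (f g : PathAlgebra σ) : f * g = mulHom σ f g := rfl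

/-- The `K`-ring structure of `K_σ Q`: the ring homomorphism `c ↦ ∑_v c e_v` from `K`. Its image is
in general not central. -/
def scalar : K →+* PathAlgebra σ where
  toFun := diag σ
  map_zero' := by simp [diag, term_zero]
  map_one' := rfl
  map_add' c d := by simp [diag, term_add, Finset.sum_add_distrib]
  map_mul' c d := by
    rw [mul_def]
    conv_rhs => rw [diag.eq_def σ d]
    rw [map_sum]
    simp only [diag_mul_term]
    rfl

/-- The path `p` as an element of `K_σ Q`. -/
def ofPath (p : Q.Path) : PathAlgebra σ := term σ p 1

/-- The arrow `a` as an element of `K_σ Q`. -/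
def arrow (a : Q.A) : PathAlgebra σ := ofPath σ (FiniteQuiver.Path.ofArrow a)

/-- The idempotent `e_v` of `K_σ Q`. -/
def idem (v : Q.V) : PathAlgebra σ := ofPath σ (FiniteQuiver.Path.trivial v)

end PathAlgebra

end PathAlgebra

/-! ## Skew polynomials -/

section Skew

variable {F K : Type*} [Field F] [Field K] [Algebra F K]

/-- The action of the powers of `σ` on `K`. -/
@[reducible] def skewAction (σ : K ≃ₐ[F] K) : MulSemiringAction (Multiplicative ℕ) K :=
  MulSemiringAction.compHom K (powersHom (K ≃ₐ[F] K) σ)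

/-- The skew polynomial ring `K[x; σ]`, in which `x c = σ(c) x` for `c ∈ K`. -/
def SkewPoly (_σ : K ≃ₐ[F] K) : Type _ := SkewPolynomial K

instance (σ : K ≃ₐ[F] K) : Ring (SkewPoly σ) :=
  letI := skewAction σ
  inferInstanceAs (Ring (SkewPolynomial K))

/-- The quadratic skew polynomial `x² - β x + γ ∈ K[x; σ]`. -/
def skewQuadratic (σ : K ≃ₐ[F] K) (β γ : K) : SkewPoly σ :=
  (SkewPolynomial.monomial 2 1 : SkewPolynomial K) - SkewPolynomial.monomial 1 β
    + SkewPolynomial.monomial 0 γ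

/-- An element `q` of `K[x; σ]` is normal if `K[x; σ] q = q K[x; σ]`. -/
def SkewPoly.IsNormal {σ : K ≃ₐ[F] K} (q : SkewPoly σ) : Prop :=
  (Set.range fun f : SkewPoly σ => f * q) = Set.range fun f : SkewPoly σ => q * f

/-- `q` is non-singular if its constant term is nonzero. -/
def SkewPoly.IsNonSingular {σ : K ≃ₐ[F] K} (q : SkewPoly σ) : Prop :=
  SkewPolynomial.coeff (R := K) q 0 ≠ 0

/-- `q` is of semisimple type if `K[x; σ] / ⟨q⟩` is a semisimple ring. -/
def SkewPoly.IsSemisimpleType {σ : K ≃ₐ[F] K} (q : SkewPoly σ) : Prop :=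
  IsSemisimpleRing (TwoSidedIdeal.span {q}).ringCon.Quotient

end Skew

/-! ## Semilinear clannish algebras -/

section Clannish

variable {F K : Type*} [Field F] [Field K] [Algebra F K] {Q : FiniteQuiver}

/-- The data by which an ideal of `K_σ Q` is given: a set of special arrows, a set of paths (the
zero-relations), and for each special arrow `s` the coefficients `β_s`, `γ_s` of the quadratic
polynomial `x² - β_s x + γ_s ∈ K[x; σ_s]`. -/
structure ClannishRelations (σ : Q.A → (K ≃ₐ[F] K)) where
  /-- the special loops -/
  special : Set Q.A
  /-- the zero-relations `Z` -/
  zeroRel : Set Q.Path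
  /-- linear coefficients -/
  β : special → K
  /-- constant coefficients -/
  γ : special → K

namespace ClannishRelations

variable {σ : Q.A → (K ≃ₐ[F] K)} (R : ClannishRelations σ)

/-- The quadratic polynomial `q_s(x) = x² - β_s x + γ_s ∈ K[x; σ_s]`. -/
def quadratic (s : R.special) : SkewPoly (σ s) := skewQuadratic (σ s) (R.β s) (R.γ s)

/-- The special relation `s² - β_s s + γ_s e_i`, where `i` is the vertex of the loop `s`. -/
def specialRel (s : R.special) : PathAlgebra σ :=
  PathAlgebra.arrow σ s * PathAlgebra.arrow σ s
    - PathAlgebra.scalar σ (R.β s) * PathAlgebra.arrow σ s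
    + PathAlgebra.scalar σ (R.γ s) * PathAlgebra.idem σ (Q.h s)

/-- The two-sided ideal `⟨Z ∪ S⟩` of `K_σ Q`. -/
def ideal : TwoSidedIdeal (PathAlgebra σ) :=
  TwoSidedIdeal.span (PathAlgebra.ofPath σ '' R.zeroRel ∪ Set.range R.specialRel)

/-- Every quadratic `q_s` is normal. -/
def NormallyBound : Prop := ∀ s, (R.quadratic s).IsNormal

/-- Every quadratic `q_s` is non-singular. -/
def NonSingular : Prop := ∀ s, (R.quadratic s).IsNonSingular

/-- Every quadratic `q_s` is of semisimple type. -/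
def SemisimpleType : Prop := ∀ s, (R.quadratic s).IsSemisimpleType

end ClannishRelations

/-- `K_σ Q / I` is a semilinear clannish algebra, with special loops, zero-relations and special
relations as listed in `R`. -/
structure IsSemilinearClannish {σ : Q.A → (K ≃ₐ[F] K)} (I : TwoSidedIdeal (PathAlgebra σ))
    (R : ClannishRelations σ) : Prop where
  /-- `K/F` is a cyclic Galois extension of finite degree. -/
  finiteDimensional : FiniteDimensional F K
  isGalois : IsGalois F K
  isCyclic : IsCyclic (K ≃ₐ[F] K)
  /-- `I = ⟨Z ∪ S⟩`. -/
  ideal_eq : I = R.ideal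
  /-- The special arrows are loops. -/
  special_loop : ∀ s ∈ R.special, Q.h s = Q.t s
  /-- At most two arrows end, and at most two arrows start, at any given vertex. -/
  head_le : ∀ i : Q.V, {b : Q.A | Q.h b = i}.encard ≤ 2
  tail_le : ∀ i : Q.V, {c : Q.A | Q.t c = i}.encard ≤ 2
  /-- The zero-relations have length at least two. -/
  two_le_length : ∀ p ∈ R.zeroRel, 2 ≤ p.arrows.length
  /-- For `a` ordinary there is at most one arrow `b` such that `b a` is a path outside `Z`. -/
  unique_left : ∀ a ∉ R.special, ∀ (b b' : Q.A) (hb : Q.t b = Q.h a) (hb' : Q.t b' = Q.h a),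
    FiniteQuiver.Path.pair b a hb ∉ R.zeroRel →
    FiniteQuiver.Path.pair b' a hb' ∉ R.zeroRel → b = b'
  /-- For `a` ordinary there is at most one arrow `b` such that `a b` is a path outside `Z`. -/
  unique_right : ∀ a ∉ R.special, ∀ (b b' : Q.A) (hb : Q.t a = Q.h b) (hb' : Q.t a = Q.h b'),
    FiniteQuiver.Path.pair a b hb ∉ R.zeroRel →
    FiniteQuiver.Path.pair a b' hb' ∉ R.zeroRel → b = b'
  /-- A zero-relation does not start or end with a special loop `s`, and does not contain `s²`. -/
  zeroRel_special : ∀ p ∈ R.zeroRel, ∀ s ∈ R.special,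
    p.arrows.head? ≠ some s ∧ p.arrows.getLast? ≠ some s ∧ ¬ [s, s] <:+: p.arrows

end Clannish

/-! ## The ground fields -/

/-- A datum of degree `d = 2 m`, of which the cases `d = 4` and `d = 2` are used: a cyclic Galois
extension `E/F` of degree `d` with a generator `ρ` of its Galois group, a primitive `d`-th root of
unity `ζ ∈ F`, and an eigenvector `v` of `ρ` with eigenvalue `ζ`. -/
structure CyclicDatum (F E : Type*) [Field F] [Field E] [Algebra F E] (m : ℕ) where
  pos : 0 < m
  finrank_eq : Module.finrank F E = 2 * m
  isGalois : IsGalois F E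
  /-- generator of the Galois group -/
  ρ : E ≃ₐ[F] E
  generates : ∀ g : E ≃ₐ[F] E, g ∈ Subgroup.zpowers ρ
  /-- primitive root of unity -/
  ζ : F
  isPrimitiveRoot : IsPrimitiveRoot ζ (2 * m)
  /-- eigenvector of `ρ` -/
  v : E
  v_ne_zero : v ≠ 0
  ρ_v : ρ v = algebraMap F E ζ * v

namespace CyclicDatum

variable {F E : Type*} [Field F] [Field E] [Algebra F E] {m : ℕ} (D : CyclicDatum F E m)

/-- The fixed field `L` of `ρ²`: the subfield of `E` of degree `2` over `F`. If `d = 2`, it is all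
of `E`. -/
def L : IntermediateField F E := IntermediateField.fixedField (Subgroup.zpowers (D.ρ ^ 2))

theorem mem_L {x : E} : x ∈ D.L ↔ D.ρ (D.ρ x) = x := by
  have h2 : ∀ y, (D.ρ ^ 2) y = D.ρ (D.ρ y) := fun y => by rw [pow_two]; rfl
  constructor
  · intro hx
    rw [← h2]
    exact (IntermediateField.mem_fixedField_iff _ _).1 hx _ (Subgroup.mem_zpowers _)
  · intro hx
    refine (IntermediateField.mem_fixedField_iff _ _).2 fun g hg => ?_
    have hle : Subgroup.zpowers (D.ρ ^ 2) ≤ MulAction.stabilizer (E ≃ₐ[F] E) x := by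
      rw [Subgroup.zpowers_le, MulAction.mem_stabilizer_iff, AlgEquiv.smul_def, h2]
      exact hx
    exact hle hg

/-- The restriction `θ` of `ρ` to `L`, which generates `Gal(L/F)`. -/
def θ : D.L ≃ₐ[F] D.L where
  toFun x := ⟨D.ρ x, D.mem_L.2 (by rw [D.mem_L.1 x.2])⟩
  invFun x := ⟨D.ρ x, D.mem_L.2 (by rw [D.mem_L.1 x.2])⟩
  left_inv x := Subtype.ext (D.mem_L.1 x.2)
  right_inv x := Subtype.ext (D.mem_L.1 x.2)
  map_mul' x y := Subtype.ext (map_mul D.ρ (x : E) y)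
  map_add' x y := Subtype.ext (map_add D.ρ (x : E) y)
  commutes' c := Subtype.ext (D.ρ.commutes c)

/-- The element `u = v^m` of `L`, that is, `u = v²` if `d = 4` and `u = v` if `d = 2`; it satisfies
`θ(u) = -u`. -/
def u : D.L :=
  ⟨D.v ^ m, by
    rw [D.mem_L, map_pow, map_pow, D.ρ_v, map_mul, D.ρ_v, D.ρ.commutes, ← mul_assoc, mul_pow,
      ← pow_two, ← pow_mul, ← map_pow, D.isPrimitiveRoot.pow_eq_one, map_one, one_mul]⟩

end CyclicDatum

/-! ## Surfaces with marked points and weighted orbifold points -/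

/-- Marked points and weighted orbifold points on a compact connected surface `X` with (possibly
empty) boundary. -/
structure WeightedMarkedSurface (X : Type*) [TopologicalSpace X] [T2Space X] [CompactSpace X]
    [ConnectedSpace X] [ChartedSpace (EuclideanHalfSpace 2) X] where
  /-- the marked points -/
  marked : Set X
  marked_finite : marked.Finite
  marked_nonempty : marked.Nonempty
  /-- Each connected component of the boundary contains a marked point. -/
  marked_meets : ∀ x ∈ (𝓡∂ 2).boundary X,
    (connectedComponentIn ((𝓡∂ 2).boundary X) x ∩ marked).Nonempty
  /-- the orbifold points -/
  orbifold : Set X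
  orbifold_finite : orbifold.Finite
  orbifold_subset : orbifold ⊆ ((𝓡∂ 2).boundary X ∪ marked)ᶜ
  /-- the weights of the orbifold points -/
  weight : orbifold → ℕ
  weight_mem : ∀ q, weight q = 1 ∨ weight q = 4

section Surface

variable {X : Type*} [TopologicalSpace X] [T2Space X] [CompactSpace X] [ConnectedSpace X]
  [ChartedSpace (EuclideanHalfSpace 2) X]

/-- All marked points lie on the boundary (which is then non-empty). -/
def WeightedMarkedSurface.IsUnpunctured (S : WeightedMarkedSurface X) : Prop :=
  S.marked ⊆ (𝓡∂ 2).boundary X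

/-- The boundary is empty, and there is exactly one marked point. -/
def WeightedMarkedSurface.IsOncePuncturedClosed (S : WeightedMarkedSurface X) : Prop :=
  (𝓡∂ 2).boundary X = ∅ ∧ ∃ p, S.marked = {p}

end Surface

/-! ## Triangulations -/

/-- The point with parameter `s ∈ [0, 1]` on the `k`-th side of the standard triangle, which runs
from the `k`-th to the `(k+1)`-st vertex. -/
def sidePoint (k : Fin 3) (s : unitInterval) : stdSimplex ℝ (Fin 3) :=
  ⟨(1 - s : ℝ) • Pi.single k (1 : ℝ) + (s : ℝ) • Pi.single (k + 1) (1 : ℝ),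
    convex_stdSimplex ℝ (Fin 3) (single_mem_stdSimplex ℝ k) (single_mem_stdSimplex ℝ (k + 1))
      (sub_nonneg.2 s.2.2) s.2.1 (by ring)⟩

/-- The midpoint of the `k`-th side of the standard triangle. -/
def sideMidpoint (k : Fin 3) : stdSimplex ℝ (Fin 3) :=
  sidePoint k ⟨1 / 2, by norm_num, by norm_num⟩

/-- A pattern for gluing `n` triangles along their sides. The sides of the triangle `t`, in the
order in which they follow each other with respect to the orientation, are `(t, 0)`, `(t, 1)`,
`(t, 2)`. A side is left free (a boundary segment), or glued to another side, or glued to itself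
by the reflection in its midpoint. -/
structure GluingPattern where
  /-- number of triangles -/
  n : ℕ
  /-- the side to which a side is glued -/
  glue : Fin n × Fin 3 → Fin n × Fin 3
  glue_glue : ∀ e, glue (glue e) = e
  /-- the sides which are boundary segments -/
  free : Set (Fin n × Fin 3)
  glue_free : ∀ e ∈ free, glue e = e

namespace GluingPattern

variable (P : GluingPattern)

/-- The sides of the triangles. -/
abbrev Side : Type := Fin P.n × Fin 3

/-- The side that follows a given one in its triangle. -/
def next (e : P.Side) : P.Side := (e.1, e.2 + 1)

/-- A side which is glued to itself. It wraps a pending arc: the half of the side from its initial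
vertex to its midpoint, to which the other half is glued, is an arc from a marked point to an
orbifold point. -/
def IsPending (e : P.Side) : Prop := e ∉ P.free ∧ P.glue e = e

/-- The elementary identifications of points of the triangles. A side is glued by the map that
reverses its direction, so that the orientations of the triangles fit together. -/
inductive Glued : Fin P.n × stdSimplex ℝ (Fin 3) → Fin P.n × stdSimplex ℝ (Fin 3) → Prop
  | glue (e : P.Side) (he : e ∉ P.free) (s : unitInterval) :
      Glued (e.1, sidePoint e.2 s) ((P.glue e).1, sidePoint (P.glue e).2 (unitInterval.symm s))

/-- Two sides which are not boundary segments are the same arc if they are equal or glued. -/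
instance arcSetoid : Setoid {e : P.Side // e ∉ P.free} where
  r e e' := e'.1 = e.1 ∨ e'.1 = P.glue e.1
  iseqv :=
    { refl := fun _ => Or.inl rfl
      symm := fun {e e'} h => by
        rcases h with h | h
        · exact Or.inl h.symm
        · exact Or.inr (by rw [h, P.glue_glue])
      trans := fun {e e' e''} h h' => by
        rcases h with h | h <;> rcases h' with h' | h'
        · exact Or.inl (h'.trans h)
        · exact Or.inr (by rw [h', h])
        · exact Or.inr (by rw [h', h])
        · exact Or.inl (by rw [h', h, P.glue_glue]) }

/-- The arcs. -/
def Arc : Type := Quotient P.arcSetoid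

instance : Finite P.Arc := inferInstanceAs (Finite (Quotient P.arcSetoid))

/-- The arc to which a side belongs. -/
def arc (e : P.Side) (he : e ∉ P.free) : P.Arc := Quotient.mk P.arcSetoid ⟨e, he⟩

/-- The arrows of the quiver `Q̄`: one for each pair consisting of a side of a triangle and the next
side of the same triangle, neither of them a boundary segment. -/
def Arrow : Type := {e : P.Side // e ∉ P.free ∧ P.next e ∉ P.free}

instance : Finite P.Arrow := Subtype.finite

/-- The tail of an arrow is the arc of the first side. -/
def Arrow.tail {P : GluingPattern} (a : P.Arrow) : P.Arc := P.arc a.1 a.2.1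

/-- The head of an arrow is the arc of the next side. -/
def Arrow.head {P : GluingPattern} (a : P.Arrow) : P.Arc := P.arc (P.next a.1) a.2.2

/-- The interior triangles: those none of whose sides is a boundary segment. -/
def InteriorTriangle : Type := {t : Fin P.n // ∀ k, (t, k) ∉ P.free}

/-- The three arrows induced by an interior triangle; the head of the `k`-th is the tail of the
`(k+1)`-st. -/
def InteriorTriangle.arrow {P : GluingPattern} (t : P.InteriorTriangle) (k : Fin 3) : P.Arrow :=
  ⟨(t.1, k), t.2 k, t.2 (k + 1)⟩

/-- The special loops: one for each pending arc. -/
def SpecialLoop : Type := {e : P.Side // P.IsPending e}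

instance : Finite P.SpecialLoop := Subtype.finite

/-- The quiver `Q̂`: its vertices are the arcs, and its arrows are those of `Q̄` and one loop at
each pending arc. -/
def hatQuiver : FiniteQuiver where
  V := P.Arc
  A := P.Arrow ⊕ P.SpecialLoop
  finV := inferInstance
  finA := inferInstance
  t := Sum.elim Arrow.tail fun s => P.arc s.1 s.2.1
  h := Sum.elim Arrow.head fun s => P.arc s.1 s.2.1

/-- The set `𝕊` of special loops of `Q̂`. -/
def specialLoops : Set P.hatQuiver.A := {b : P.Arrow ⊕ P.SpecialLoop | b.isRight = true}

theorem InteriorTriangle.composable {P : GluingPattern} (t : P.InteriorTriangle) (k : Fin 3) :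
    P.hatQuiver.t (Sum.inl (t.arrow (k + 1))) = P.hatQuiver.h (Sum.inl (t.arrow k)) := rfl

/-- The set `Z` of zero-relations: the paths of length two formed by two consecutive arrows of the
same interior triangle. -/
def zeroRel : Set P.hatQuiver.Path :=
  {p | ∃ (t : P.InteriorTriangle) (k : Fin 3),
    p = FiniteQuiver.Path.pair _ _ (t.composable k)}

/-- The differential `∂₂ : 𝔽₂ X₂ → 𝔽₂ X₁`, which takes an interior triangle to the sum of the three
arrows that it induces. -/
def boundary₂ : (P.InteriorTriangle →₀ ZMod 2) →ₗ[ZMod 2] (P.Arrow →₀ ZMod 2) :=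
  Finsupp.linearCombination (ZMod 2) fun t => ∑ k : Fin 3, Finsupp.single (t.arrow k) 1

/-- The 1-cocycles: the elements of the dual of `𝔽₂ X₁` that vanish on the image of `∂₂`. -/
def cocycles : Submodule (ZMod 2) (Module.Dual (ZMod 2) (P.Arrow →₀ ZMod 2)) :=
  LinearMap.ker P.boundary₂.dualMap

end GluingPattern

section Triangulation

variable {X : Type*} [TopologicalSpace X] [T2Space X] [CompactSpace X] [ConnectedSpace X]
  [ChartedSpace (EuclideanHalfSpace 2) X]

/-- A triangulation of an oriented surface with marked points and orbifold points, together with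
the orientation: cutting the surface along the arcs leaves finitely many triangles, from which the
surface is recovered by gluing sides in pairs. The two sides of a non-pending arc are two sides of
triangles, and a pending arc is wrapped by one side of a triangle, which is folded at its midpoint,
the orbifold point. -/
structure Triangulation (S : WeightedMarkedSurface X) extends GluingPattern where
  /-- the maps from the standard triangle to the surface -/
  map : Fin n → stdSimplex ℝ (Fin 3) → X
  continuous_map : ∀ t, Continuous (map t)
  map_surjective : ∀ x, ∃ t p, map t p = x
  /-- Two points of the triangles become the same point of the surface exactly if the gluing
  identifies them. -/
  map_eq_iff : ∀ t p t' p',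
    map t p = map t' p' ↔ Relation.EqvGen toGluingPattern.Glued (t, p) (t', p')
  /-- The marked points are the images of the vertices. -/
  marked_eq : S.marked = {x | ∃ t k, map t (sidePoint k 0) = x}
  /-- The orbifold points are the images of the midpoints of the sides glued to themselves. -/
  orbifold_eq : S.orbifold =
    {x | ∃ e, toGluingPattern.IsPending e ∧ map e.1 (sideMidpoint e.2) = x}
  /-- The boundary of the surface is the union of the boundary segments. -/
  boundary_eq : (𝓡∂ 2).boundary X = {x | ∃ e ∈ free, ∃ s, map e.1 (sidePoint e.2 s) = x}

namespace Triangulation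

variable {S : WeightedMarkedSurface X} (τ : Triangulation S)

/-- The orbifold point on a pending arc. -/
def orbifoldPoint (s : τ.SpecialLoop) : S.orbifold :=
  ⟨τ.map s.1.1 (sideMidpoint s.1.2), by rw [τ.orbifold_eq]; exact ⟨s.1, s.2, rfl⟩⟩

/-- The weight `d(τ, ω)_j` of a pending arc `j`: the weight of the orbifold point on it. -/
def loopWeight (s : τ.SpecialLoop) : ℕ := S.weight (τ.orbifoldPoint s)

variable {F E : Type*} [Field F] [Field E] [Algebra F E] {m : ℕ} (D : CyclicDatum F E m)
  (ξ : Module.Dual (ZMod 2) (τ.Arrow →₀ ZMod 2))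

/-- The field automorphisms `σ(τ, ξ)_a`: they are `θ ^ ξ_a` for an arrow `a` of `Q̄`, and for the
loop at a pending arc they are `θ` if its weight is `1` and the identity if its weight is `4`. -/
def sigma : τ.hatQuiver.A → (D.L ≃ₐ[F] D.L) :=
  Sum.elim (fun a => D.θ ^ (ξ (Finsupp.single a 1)).val)
    fun s => if τ.loopWeight s = 1 then D.θ else 1

/-- The element `μ` such that `q_s(x) = x² - μ`: it is `1` for a pending arc of weight `1` and `u`
for a pending arc of weight `4`. -/
def loopScalar (s : τ.SpecialLoop) : D.L := if τ.loopWeight s = 1 then 1 else D.u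

/-- The special loops, the zero-relations `Z(τ, ξ)`, and the quadratic polynomials
`q_s(x) = x² - μ`. -/
def relations : ClannishRelations (τ.sigma D ξ) where
  special := τ.specialLoops
  zeroRel := τ.zeroRel
  β _ := 0
  γ s := -τ.loopScalar D (Sum.getRight s.1 s.2)

/-- The ideal `I(τ, ξ)` of the semilinear path algebra `L_σ Q̂(τ)`, generated by `Z(τ, ξ)` and the
elements `s² - e_k` (weight `1`) and `s² - u e_k` (weight `4`), where `s` is the special loop at the
pending arc `k`. -/
def relationIdeal : TwoSidedIdeal (PathAlgebra (τ.sigma D ξ)) :=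
  TwoSidedIdeal.span
    (PathAlgebra.ofPath (τ.sigma D ξ) '' τ.zeroRel ∪
      Set.range fun s : τ.SpecialLoop =>
        PathAlgebra.arrow (τ.sigma D ξ) (Sum.inr s) * PathAlgebra.arrow (τ.sigma D ξ) (Sum.inr s)
          - PathAlgebra.scalar (τ.sigma D ξ) (τ.loopScalar D s)
            * PathAlgebra.idem (τ.sigma D ξ) (τ.arc s.1 s.2.1))

end Triangulation

end Triangulation

end

/-!
The clannish conditions on the quiver are local at an arc, and use only the combinatorics of the
gluing pattern. A non-pending arc is two sides of triangles, a pending arc is one side together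
with its special loop; either way there are two slots (`GluingPattern.slots`) through which arrows
leave or enter the arc, and an arrow is determined by its slot and direction
(`tailSlot_injective`, `headSlot_injective`). Hence at most two arrows start and at most two end at
each vertex. An ordinary arrow `a` enters its head through a side of its own triangle; the only
arrow that can leave through that same side is the next one in this triangle, and if it exists, the
triangle is interior and the composite lies in `Z` (`pair_mem_zeroRel`). So a continuation of `a`
outside `Z` has to use the other slot, and is unique; likewise on the other side.

For every special loop the twist `σ` satisfies `σ² = 1` and fixes the scalar `c` (`1` or `u`) of the
quadratic polynomial `x² - c`. Therefore `x² - c` is central in `L[x; σ]`, in particular normal, and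
it is non-singular because `c ≠ 0`. In the quotient by `x² - c` the class of `x` is a unit which
normalises `L` and whose square lies in `L`. Since `2` is invertible, `F` containing a primitive
root of unity of even order, an `L`-linear projection onto a left ideal can be averaged with its
conjugate by `x` to a projection that is linear over the quotient. This makes the quotient
semisimple (`isSemisimpleRing_of_semilinear_root`), whether or not `σ` is trivial.
-/

/-! ### Semisimplicity by averaging -/

/-- Maschke's theorem for crossed products of order two: a ring generated by a field `K` and an
element `x` with `x a = σ(a) x` for `a ∈ K` and `x² = c ∈ K` is semisimple, provided that `2` and
`c` are invertible, `σ² = 1` and `σ` fixes `c`. -/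
theorem isSemisimpleRing_of_semilinear_root {A K : Type*} [Ring A] [Field K] (ι : K →+* A)
    (σ : K ≃+* K) (x : A) (c : K) (h2 : (2 : K) ≠ 0) (hc : c ≠ 0) (hσc : σ c = c)
    (hσσ : ∀ a, σ (σ a) = a) (hx : ∀ a, x * ι a = ι (σ a) * x) (hxx : x * x = ι c)
    (hgen : Subring.closure (Set.range ι ∪ {x}) = ⊤) : IsSemisimpleRing A := by
  let _ : Module K A := Module.compHom A ι
  have smul_eq (a : K) (m : A) : a • m = ι a * m := rfl
  have : IsScalarTower K A A := ⟨fun a r m => by simp only [smul_eq, smul_eq_mul, mul_assoc]⟩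
  have hx' (a : K) (m : A) : x * (ι a * m) = ι (σ a) * (x * m) := by
    rw [← mul_assoc, hx, mul_assoc]
  have hxx' (m : A) : x * (x * m) = ι c * m := by rw [← mul_assoc, hxx]
  have hι (a b : K) (m : A) : ι a * (ι b * m) = ι (a * b) * m := by rw [map_mul, mul_assoc]
  have : ComplementedLattice (Submodule A A) := by
    refine ⟨fun N => ?_⟩
    obtain ⟨p, hp⟩ := LinearMap.exists_leftInverse_of_injective (N.restrictScalars K).subtype
      (Submodule.ker_subtype _)
    have hpN (n : A) (hn : n ∈ N) : (p n : A) = n :=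
      congrArg Subtype.val (DFunLike.congr_fun hp ⟨n, hn⟩)
    have hpι (a : K) (m : A) : (p (ι a * m) : A) = ι a * p m :=
      congrArg Subtype.val (p.map_smul a m)
    -- The average of `p` and of its conjugate by the unit `x`, whose inverse is `c⁻¹ x`.
    let f (m : A) : A := ι 2⁻¹ * (p m + x * p (ι c⁻¹ * (x * m)))
    have hfN (m : A) : f m ∈ N :=
      N.smul_mem _ (N.add_mem (p m).2 (N.smul_mem _ (p _).2))
    have hfadd (m m' : A) : f (m + m') = f m + f m' := by
      simp only [f, mul_add, map_add, Submodule.coe_add]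
      abel
    have hfzero : f 0 = 0 := by simp [f]
    have hfι (a : K) (m : A) : f (ι a * m) = ι a * f m := by
      simp only [f, mul_add, hx', hι, hpι, hσσ, map_inv₀ σ, hσc, mul_comm a]
    have hfx (m : A) : f (x * m) = x * f m := by
      have hσ2 : σ 2 = 2 := map_ofNat σ 2
      have hy : c⁻¹ * c = 1 := inv_mul_cancel₀ hc
      simp only [f, mul_add, hxx', hx', hι, hpι, map_mul σ, map_inv₀ σ, hσc, hσ2, mul_assoc, hy,
        mul_one]
      rw [add_comm]
    have hfmul (r m : A) : f (r * m) = r * f m := by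
      have hr : r ∈ Subring.closure (Set.range ι ∪ {x}) := hgen ▸ Subring.mem_top r
      induction hr using Subring.closure_induction generalizing m with
      | mem r hr =>
        rcases hr with ⟨a, rfl⟩ | rfl
        · exact hfι a m
        · exact hfx m
      | zero => simp [hfzero]
      | one => simp
      | add r s _ _ hr hs => rw [add_mul, hfadd, hr, hs, add_mul]
      | neg r _ hr =>
        rw [← add_right_inj (f (r * m)), ← hfadd, hr]
        simp [hfzero]
      | mul r s _ _ hr hs => rw [mul_assoc, hr, hs, mul_assoc]
    have hfid (n : A) (hn : n ∈ N) : f n = n := by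
      have h := N.smul_mem (ι c⁻¹) (N.smul_mem x hn)
      simp only [smul_eq_mul] at h
      simp only [f, hpN n hn, hpN _ h, hx', hxx', hι, map_inv₀ σ, hσc, inv_mul_cancel₀ hc, map_one,
        one_mul]
      rw [← two_mul, ← map_ofNat ι 2, hι, inv_mul_cancel₀ h2, map_one, one_mul]
    let g : A →ₗ[A] N :=
      { toFun := fun m => ⟨f m, hfN m⟩
        map_add' := fun m m' => Subtype.ext (hfadd m m')
        map_smul' := fun r m => Subtype.ext (hfmul r m) }
    exact ⟨_, LinearMap.isCompl_of_proj (f := g) fun n => Subtype.ext (hfid n n.2)⟩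
  exact { toComplementedLattice := this }

/-! ### Skew polynomials `x² - c` -/

namespace SkewPolynomial

theorem coeff_zero_quadratic {K : Type*} [Field K] (β γ : K) :
    (monomial 2 1 - monomial 1 β + monomial 0 γ : SkewPolynomial K).coeff 0 = γ := by
  rw [sub_eq_add_neg, ← map_neg, coeff_add, coeff_add, coeff_monomial, coeff_monomial,
    coeff_monomial]
  simp

variable {K : Type*} [Field K] [MulSemiringAction (Multiplicative ℕ) K]

/-- If the twist `φ` is an involution that fixes `c`, then `x² - c` is central. -/
theorem mul_quadratic_comm {c : K} (h : ∀ a : K, φ (φ a) = a) (hc : φ c = c)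
    (f : SkewPolynomial K) :
    f * (monomial 2 1 - monomial 1 0 + monomial 0 (-c)) =
      (monomial 2 1 - monomial 1 0 + monomial 0 (-c)) * f := by
  have hcn (n : ℕ) : φ^[n] c = c := Function.iterate_fixed hc n
  induction f using SkewPolynomial.induction with
  | h0 => simp
  | ha n r q _ _ ih =>
    rw [add_mul, ih, mul_add]
    simp only [mul_add, add_mul, monomial_zero_right, sub_zero, monomial_mul_monomial,
      Function.iterate_succ, Function.iterate_zero, Function.comp_apply, id_eq, h, map_neg,
      iterate_map_one, hcn, add_comm n, zero_add, mul_neg, neg_mul, one_mul, mul_comm r]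

theorem closure_range_C_union_X :
    Subring.closure (Set.range (CRingHom (R := K)) ∪ {X}) = ⊤ := by
  refine eq_top_iff.2 fun f _ => ?_
  induction f using SkewPolynomial.induction with
  | h0 => exact zero_mem _
  | ha n r q _ _ ih =>
    refine add_mem ?_ (ih trivial)
    rw [← C_mul_X_pow_eq_monomial]
    have hX : (X : SkewPolynomial K) ∈ Subring.closure (Set.range (CRingHom (R := K)) ∪ {X}) :=
      Subring.subset_closure (Or.inr rfl)
    exact mul_mem (Subring.subset_closure (Or.inl ⟨r, rfl⟩)) (pow_mem hX n)

theorem isSemisimpleRing_quotient {c : K} (σ : K ≃+* K) (hφ : ∀ a : K, φ a = σ a)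
    (h2 : (2 : K) ≠ 0) (hc : c ≠ 0) (hσσ : ∀ a, σ (σ a) = a) (hσc : σ c = c) :
    IsSemisimpleRing (TwoSidedIdeal.span
      {(monomial 2 1 - monomial 1 0 + monomial 0 (-c) : SkewPolynomial K)}).ringCon.Quotient := by
  set I := TwoSidedIdeal.span
      {(monomial 2 1 - monomial 1 0 + monomial 0 (-c) : SkewPolynomial K)}
  refine isSemisimpleRing_of_semilinear_root (I.ringCon.mk'.comp CRingHom) σ (I.ringCon.mk' X) c
    h2 hc hσc hσσ (fun a => ?_) ?_ ?_
  · rw [RingHom.comp_apply, RingHom.comp_apply, ← map_mul, ← map_mul, CRingHom_eq_C,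
      CRingHom_eq_C, ← monomial_one_one_eq_X, monomial_mul_C, C_mul_monomial]
    simp [hφ]
  · rw [RingHom.comp_apply, ← map_mul, ← sub_eq_zero, ← map_sub, ← TwoSidedIdeal.mem_ker,
      TwoSidedIdeal.ker_ringCon_mk']
    refine TwoSidedIdeal.subset_span (Set.mem_singleton_iff.2 ?_)
    rw [← monomial_one_one_eq_X, monomial_mul_monomial, CRingHom_eq_C, monomial_zero_right,
      map_neg, iterate_map_one, mul_one, sub_zero, ← sub_eq_add_neg]
    rfl
  · rw [RingHom.coe_comp, Set.range_comp, ← Set.image_singleton, ← Set.image_union,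
      ← RingHom.map_closure, closure_range_C_union_X, ← RingHom.range_eq_map]
    exact RingHom.range_eq_top.2 I.ringCon.mk'_surjective

end SkewPolynomial

section SkewPoly

variable {F K : Type*} [Field F] [Field K] [Algebra F K] {σ : K ≃ₐ[F] K} {c : K}

/-- The twist of `K[x; σ]`, as Mathlib reads it off the action of `Multiplicative ℕ`, is `σ`. -/
theorem skewAction_φ (σ : K ≃ₐ[F] K) (a : K) :
    (letI := skewAction σ; SkewPolynomial.φ a) = σ a := by
  change ((powersHom (K ≃ₐ[F] K) σ) (Multiplicative.ofAdd 1)) a = σ a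
  simp

theorem isNormal_skewQuadratic (hσ : ∀ a, σ (σ a) = a) (hc : σ c = c) :
    (skewQuadratic σ 0 (-c)).IsNormal := by
  let _ := skewAction σ
  have h (f : SkewPoly σ) : f * skewQuadratic σ 0 (-c) = skewQuadratic σ 0 (-c) * f :=
    SkewPolynomial.mul_quadratic_comm (fun a => by simp only [skewAction_φ, hσ])
      ((skewAction_φ σ c).trans hc) f
  simp only [SkewPoly.IsNormal, h]

theorem isNonSingular_skewQuadratic (β : K) {γ : K} (h : γ ≠ 0) :
    (skewQuadratic σ β γ).IsNonSingular := by
  let _ := skewAction σ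
  exact (SkewPolynomial.coeff_zero_quadratic β γ).trans_ne h

theorem isSemisimpleType_skewQuadratic (h2 : (2 : K) ≠ 0) (hc0 : c ≠ 0)
    (hσ : ∀ a, σ (σ a) = a) (hc : σ c = c) : (skewQuadratic σ 0 (-c)).IsSemisimpleType := by
  let _ := skewAction σ
  exact SkewPolynomial.isSemisimpleRing_quotient σ.toRingEquiv (skewAction_φ σ) h2 hc0 hσ hc

end SkewPoly

/-! ### The quadratic extension `L/F` -/

namespace CyclicDatum

variable {F E : Type*} [Field F] [Field E] [Algebra F E] {m : ℕ} (D : CyclicDatum F E m)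

theorem isCyclic (D : CyclicDatum F E m) : IsCyclic (E ≃ₐ[F] E) := ⟨D.ρ, D.generates⟩

theorem finiteDimensional (D : CyclicDatum F E m) : FiniteDimensional F E :=
  Module.finite_of_finrank_pos (by rw [D.finrank_eq]; have := D.pos; omega)

theorem isGalois_L : IsGalois F D.L := by
  have := D.isGalois
  have := D.isCyclic
  have := D.finiteDimensional
  have : (Subgroup.zpowers (D.ρ ^ 2)).Normal := by
    let _ := IsCyclic.commGroup (α := E ≃ₐ[F] E)
    infer_instance
  exact IsGalois.of_fixedField_normal_subgroup _

theorem isCyclic_L : IsCyclic (D.L ≃ₐ[F] D.L) := by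
  have := D.isGalois
  have := D.isCyclic
  have := D.isGalois_L
  exact isCyclic_of_surjective (AlgEquiv.restrictNormalHom (F := F) (K₁ := E) D.L)
    (AlgEquiv.restrictNormalHom_surjective E)

theorem θ_θ (a : D.L) : D.θ (D.θ a) = a := Subtype.ext (D.mem_L.1 a.2)

theorem u_ne_zero : D.u ≠ 0 := fun h => pow_ne_zero m D.v_ne_zero (congrArg Subtype.val h)

/-- The characteristic is not `2`, since `F` contains a primitive root of unity of even order. -/
theorem two_ne_zero_L : (2 : D.L) ≠ 0 := by
  have : NeZero (2 * m) := ⟨by have := D.pos; omega⟩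
  have h := (D.isPrimitiveRoot.neZero').out
  intro h2
  apply h
  have : (2 : F) = 0 := by
    apply (algebraMap F D.L).injective
    rw [map_ofNat, map_zero, h2]
  push_cast
  rw [this, zero_mul]

end CyclicDatum

/-! ### Arrows at an arc and zero-relations -/

namespace GluingPattern

variable {P : GluingPattern}

theorem arc_eq_arc_iff {e f : P.Side} (he : e ∉ P.free) (hf : f ∉ P.free) :
    P.arc e he = P.arc f hf ↔ f = e ∨ f = P.glue e :=
  Quotient.eq (r := P.arcSetoid)

theorem next_next_next (e : P.Side) : P.next (P.next (P.next e)) = e := by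
  ext1
  · rfl
  · simp only [next]
    omega

theorem next_injective : Function.Injective P.next := fun e f h => by
  rw [← next_next_next e, h, next_next_next]

/-- The two slots at the arc of the side `e`. If the arc is not pending, they are the sides `e` and
`P.glue e`, marked `false`; if it is pending, the second slot is the marked side `(e, true)`, and it
is reserved for the special loop. -/
def slots (e : P.Side) : Set (P.Side × Bool) := {(e, false), (P.glue e, decide (P.glue e = e))}

theorem encard_slots_le (e : P.Side) : (slots e).encard ≤ 2 :=
  (Set.encard_insert_le _ _).trans (by rw [Set.encard_singleton, one_add_one_eq_two])

/-- The slot by which an arrow leaves its tail. -/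
def tailSlot : P.hatQuiver.A → P.Side × Bool :=
  Sum.elim (fun a : P.Arrow => (a.1, false)) fun s : P.SpecialLoop => (s.1, true)

/-- The slot by which an arrow enters its head. -/
def headSlot : P.hatQuiver.A → P.Side × Bool :=
  Sum.elim (fun a : P.Arrow => (P.next a.1, false)) fun s : P.SpecialLoop => (s.1, true)

theorem tailSlot_injective : Function.Injective (tailSlot (P := P)) := by
  rintro (a | s) (b | t) h
  · exact congrArg Sum.inl (Subtype.ext (congrArg Prod.fst h))
  · exact absurd (congrArg Prod.snd h) Bool.false_ne_true
  · exact absurd (congrArg Prod.snd h).symm Bool.false_ne_true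
  · exact congrArg Sum.inr (Subtype.ext (congrArg Prod.fst h))

theorem headSlot_injective : Function.Injective (headSlot (P := P)) := by
  rintro (a | s) (b | t) h
  · exact congrArg Sum.inl (Subtype.ext (next_injective (congrArg Prod.fst h)))
  · exact absurd (congrArg Prod.snd h) Bool.false_ne_true
  · exact absurd (congrArg Prod.snd h).symm Bool.false_ne_true
  · exact congrArg Sum.inr (Subtype.ext (congrArg Prod.fst h))

theorem mem_slots_of_arc_eq {e f : P.Side} (he : e ∉ P.free) (hf : f ∉ P.free)
    (h : P.arc f hf = P.arc e he) : (f, false) ∈ slots e := by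
  rcases (arc_eq_arc_iff hf he).1 h with rfl | rfl
  · exact Or.inl rfl
  · by_cases hfe : P.glue f = f
    · exact Or.inl (by rw [hfe])
    · refine Or.inr ?_
      rw [P.glue_glue, decide_eq_false (Ne.symm hfe)]
      rfl

theorem loop_mem_slots {e : P.Side} (he : e ∉ P.free) (s : P.SpecialLoop)
    (h : P.arc s.1 s.2.1 = P.arc e he) : (s.1, true) ∈ slots e := by
  have hs : e = s.1 := by
    -- A pending side is its own glued partner, hence the only side of its arc.
    rcases (arc_eq_arc_iff s.2.1 he).1 h with h | h
    · exact h
    · rw [h, s.2.2]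
  subst hs
  refine Or.inr ?_
  rw [s.2.2, decide_eq_true rfl]
  rfl

theorem tailSlot_mem {e : P.Side} (he : e ∉ P.free) (b : P.hatQuiver.A)
    (hb : P.hatQuiver.t b = P.arc e he) : tailSlot b ∈ slots e := by
  rcases b with b | s
  · exact mem_slots_of_arc_eq he b.2.1 hb
  · exact loop_mem_slots he s hb

theorem headSlot_mem {e : P.Side} (he : e ∉ P.free) (b : P.hatQuiver.A)
    (hb : P.hatQuiver.h b = P.arc e he) : headSlot b ∈ slots e := by
  rcases b with b | s
  · exact mem_slots_of_arc_eq he b.2.2 hb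
  · exact loop_mem_slots he s hb

theorem exists_arc_eq (i : P.hatQuiver.V) : ∃ (e : P.Side) (he : e ∉ P.free), i = P.arc e he := by
  obtain ⟨e, rfl⟩ := Quotient.exists_rep i
  exact ⟨e.1, e.2, rfl⟩

theorem encard_tail_eq_le (i : P.hatQuiver.V) :
    {b : P.hatQuiver.A | P.hatQuiver.t b = i}.encard ≤ 2 := by
  obtain ⟨e, he, rfl⟩ := exists_arc_eq i
  exact (Set.encard_le_encard_of_injOn (fun b hb => tailSlot_mem he b hb)
    tailSlot_injective.injOn).trans (encard_slots_le e)

theorem encard_head_eq_le (i : P.hatQuiver.V) :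
    {b : P.hatQuiver.A | P.hatQuiver.h b = i}.encard ≤ 2 := by
  obtain ⟨e, he, rfl⟩ := exists_arc_eq i
  exact (Set.encard_le_encard_of_injOn (fun b hb => headSlot_mem he b hb)
    headSlot_injective.injOn).trans (encard_slots_le e)

/-- Two consecutive arrows of one triangle use all three of its sides, so that the triangle is
interior and their composite is a zero-relation. -/
theorem pair_mem_zeroRel {a b : P.Arrow} (hab : b.1 = P.next a.1)
    (h : P.hatQuiver.t (Sum.inl b) = P.hatQuiver.h (Sum.inl a)) :
    FiniteQuiver.Path.pair (Q := P.hatQuiver) (Sum.inl b) (Sum.inl a) h ∈ P.zeroRel := by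
  obtain ⟨⟨t, k⟩, ha⟩ := a
  obtain ⟨e, hb⟩ := b
  obtain rfl : e = (t, k + 1) := hab
  refine ⟨⟨t, fun j => ?_⟩, k, rfl⟩
  have h0 : (t, k) ∉ P.free := ha.1
  have h1 : (t, k + 1) ∉ P.free := hb.1
  have h2 : (t, k + 1 + 1) ∉ P.free := hb.2
  obtain rfl | rfl | rfl : j = k ∨ j = k + 1 ∨ j = k + 1 + 1 := by omega
  exacts [h0, h1, h2]

theorem eq_of_pair_notMem_zeroRel_left (a : P.Arrow) (b b' : P.hatQuiver.A)
    (hb : P.hatQuiver.t b = P.hatQuiver.h (Sum.inl a))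
    (hb' : P.hatQuiver.t b' = P.hatQuiver.h (Sum.inl a))
    (hZ : FiniteQuiver.Path.pair b (Sum.inl a) hb ∉ P.zeroRel)
    (hZ' : FiniteQuiver.Path.pair b' (Sum.inl a) hb' ∉ P.zeroRel) : b = b' := by
  -- Only the slot other than the side `next a` itself is available.
  have key (c : P.hatQuiver.A) (hc : P.hatQuiver.t c = P.hatQuiver.h (Sum.inl a))
      (hcZ : FiniteQuiver.Path.pair c (Sum.inl a) hc ∉ P.zeroRel) :
      tailSlot c = (P.glue (P.next a.1), decide (P.glue (P.next a.1) = P.next a.1)) := by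
    refine (tailSlot_mem a.2.2 c hc).resolve_left fun h => ?_
    rcases c with c | s
    · exact hcZ (pair_mem_zeroRel (congrArg Prod.fst h) hc)
    · exact absurd (congrArg Prod.snd h).symm Bool.false_ne_true
  exact tailSlot_injective ((key b hb hZ).trans (key b' hb' hZ').symm)

theorem eq_of_pair_notMem_zeroRel_right (a : P.Arrow) (b b' : P.hatQuiver.A)
    (hb : P.hatQuiver.t (Sum.inl a) = P.hatQuiver.h b)
    (hb' : P.hatQuiver.t (Sum.inl a) = P.hatQuiver.h b')
    (hZ : FiniteQuiver.Path.pair (Sum.inl a) b hb ∉ P.zeroRel)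
    (hZ' : FiniteQuiver.Path.pair (Sum.inl a) b' hb' ∉ P.zeroRel) : b = b' := by
  -- Only the slot other than the side `a` itself is available.
  have key (c : P.hatQuiver.A) (hc : P.hatQuiver.t (Sum.inl a) = P.hatQuiver.h c)
      (hcZ : FiniteQuiver.Path.pair (Sum.inl a) c hc ∉ P.zeroRel) :
      headSlot c = (P.glue a.1, decide (P.glue a.1 = a.1)) := by
    refine (headSlot_mem a.2.1 c hc.symm).resolve_left fun h => ?_
    rcases c with c | s
    · exact hcZ (pair_mem_zeroRel (congrArg Prod.fst h).symm hc)
    · exact absurd (congrArg Prod.snd h).symm Bool.false_ne_true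
  exact headSlot_injective ((key b hb hZ).trans (key b' hb' hZ').symm)

theorem length_eq_two_of_mem_zeroRel {p : P.hatQuiver.Path} (hp : p ∈ P.zeroRel) :
    p.arrows.length = 2 := by
  obtain ⟨t, k, rfl⟩ := hp
  rfl

theorem notMem_specialLoops_of_mem_zeroRel {p : P.hatQuiver.Path} (hp : p ∈ P.zeroRel)
    {b : P.hatQuiver.A} (hb : b ∈ p.arrows) : b ∉ P.specialLoops := by
  obtain ⟨t, k, rfl⟩ := hp
  rcases List.mem_cons.1 hb with rfl | hb
  · exact Bool.false_ne_true
  · obtain rfl := List.mem_singleton.1 hb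
    exact Bool.false_ne_true

end GluingPattern

/-! ### The algebra of a triangulation -/

namespace Triangulation

variable {X : Type*} [TopologicalSpace X] [T2Space X] [CompactSpace X] [ConnectedSpace X]
  [ChartedSpace (EuclideanHalfSpace 2) X] {S : WeightedMarkedSurface X} (τ : Triangulation S)
  {F E : Type*} [Field F] [Field E] [Algebra F E] {m : ℕ} (D : CyclicDatum F E m)
  (ξ : Module.Dual (ZMod 2) (τ.Arrow →₀ ZMod 2))

theorem loopScalar_ne_zero (s : τ.SpecialLoop) : τ.loopScalar D s ≠ 0 := by
  unfold loopScalar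
  split_ifs
  exacts [one_ne_zero, D.u_ne_zero]

theorem sigma_loop_sigma_loop (s : τ.SpecialLoop) (a : D.L) :
    τ.sigma D ξ (Sum.inr s) (τ.sigma D ξ (Sum.inr s) a) = a := by
  simp only [sigma, Sum.elim_inr]
  split_ifs
  exacts [D.θ_θ a, rfl]

theorem sigma_loop_loopScalar (s : τ.SpecialLoop) :
    τ.sigma D ξ (Sum.inr s) (τ.loopScalar D s) = τ.loopScalar D s := by
  simp only [sigma, loopScalar, Sum.elim_inr]
  split_ifs
  exacts [map_one D.θ, rfl]

theorem exists_eq_of_special (b : (τ.relations D ξ).special) :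
    ∃ s : τ.SpecialLoop, b = ⟨Sum.inr s, rfl⟩ := by
  obtain ⟨a | s, hs⟩ := b
  · exact absurd hs Bool.false_ne_true
  · exact ⟨s, rfl⟩

theorem relationIdeal_eq : τ.relationIdeal D ξ = (τ.relations D ξ).ideal := by
  have h : (Set.range fun s : τ.SpecialLoop =>
        PathAlgebra.arrow (τ.sigma D ξ) (Sum.inr s) * PathAlgebra.arrow (τ.sigma D ξ) (Sum.inr s)
          - PathAlgebra.scalar (τ.sigma D ξ) (τ.loopScalar D s)
            * PathAlgebra.idem (τ.sigma D ξ) (τ.arc s.1 s.2.1)) =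
      Set.range (τ.relations D ξ).specialRel := by
    have hs (s : τ.SpecialLoop) : (τ.relations D ξ).specialRel ⟨Sum.inr s, rfl⟩ =
        PathAlgebra.arrow (τ.sigma D ξ) (Sum.inr s) * PathAlgebra.arrow (τ.sigma D ξ) (Sum.inr s)
          - PathAlgebra.scalar (τ.sigma D ξ) (τ.loopScalar D s)
            * PathAlgebra.idem (τ.sigma D ξ) (τ.arc s.1 s.2.1) := by
      change _ - PathAlgebra.scalar (τ.sigma D ξ) 0 * _
        + PathAlgebra.scalar (τ.sigma D ξ) (-τ.loopScalar D s) * _ = _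
      rw [map_zero, zero_mul, sub_zero, map_neg, neg_mul, ← sub_eq_add_neg]
      rfl
    refine Set.Subset.antisymm ?_ ?_
    · rintro _ ⟨s, rfl⟩
      exact ⟨_, hs s⟩
    · rintro _ ⟨s, rfl⟩
      obtain ⟨s, rfl⟩ := τ.exists_eq_of_special D ξ s
      exact ⟨s, (hs s).symm⟩
  unfold relationIdeal ClannishRelations.ideal
  rw [h]
  rfl

theorem isSemilinearClannish :
    IsSemilinearClannish (τ.relationIdeal D ξ) (τ.relations D ξ) where
  finiteDimensional := have := D.finiteDimensional; inferInstance
  isGalois := D.isGalois_L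
  isCyclic := D.isCyclic_L
  ideal_eq := τ.relationIdeal_eq D ξ
  special_loop := by
    rintro (a | s) hs
    · exact absurd hs Bool.false_ne_true
    · rfl
  head_le := GluingPattern.encard_head_eq_le
  tail_le := GluingPattern.encard_tail_eq_le
  two_le_length p hp := (GluingPattern.length_eq_two_of_mem_zeroRel hp).ge
  unique_left := by
    rintro (a | s) ha
    · exact GluingPattern.eq_of_pair_notMem_zeroRel_left a
    · exact absurd rfl ha
  unique_right := by
    rintro (a | s) ha
    · exact GluingPattern.eq_of_pair_notMem_zeroRel_right a
    · exact absurd rfl ha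
  zeroRel_special p hp s hs := by
    have h (hsp : s ∈ p.arrows) : False :=
      GluingPattern.notMem_specialLoops_of_mem_zeroRel hp hsp hs
    exact ⟨fun h' => h (List.mem_of_head? h'), fun h' => h (List.mem_of_getLast? h'),
      fun h' => h (h'.subset List.mem_cons_self)⟩

end Triangulation

theorem mainTheorem4 {X : Type*} [TopologicalSpace X] [T2Space X] [CompactSpace X]
    [ConnectedSpace X] [ChartedSpace (EuclideanHalfSpace 2) X] (S : WeightedMarkedSurface X)
    (hS : S.IsUnpunctured ∨ S.IsOncePuncturedClosed) (τ : Triangulation S)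
    (ξ : Module.Dual (ZMod 2) (τ.Arrow →₀ ZMod 2)) (hξ : ξ ∈ τ.cocycles)
    {F E : Type*} [Field F] [Field E] [Algebra F E] {m : ℕ} (D : CyclicDatum F E m)
    (hm : m = 2 ∨ (m = 1 ∧ ∀ q, S.weight q = 1)) :
    IsSemilinearClannish (τ.relationIdeal D ξ) (τ.relations D ξ) ∧
      (τ.relations D ξ).NormallyBound ∧
      (τ.relations D ξ).NonSingular ∧
      (τ.relations D ξ).SemisimpleType := by
  refine ⟨τ.isSemilinearClannish D ξ, ?_, ?_, ?_⟩ <;> intro s <;>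
    obtain ⟨s, rfl⟩ := τ.exists_eq_of_special D ξ s
  · exact isNormal_skewQuadratic (τ.sigma_loop_sigma_loop D ξ s) (τ.sigma_loop_loopScalar D ξ s)
  · exact isNonSingular_skewQuadratic _ (neg_ne_zero.2 (τ.loopScalar_ne_zero D s))
  · exact isSemisimpleType_skewQuadratic D.two_ne_zero_L (τ.loopScalar_ne_zero D s)
      (τ.sigma_loop_sigma_loop D ξ s) (τ.sigma_loop_loopScalar D ξ s)
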